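/- In the $B$-Congested Clique, $n$ nodes with identities $1,\dots,n$ form a complete graph and communicate in synchronous rounds; in each round every node may send a (possibly different) $B$-bit message to every node. In the problem $\mathsf{AllToAllComm}$ each node $u$ is given $B$-bit messages $m_{u,v}$, one for each node $v$, and each node $v$ has to output all the messages $m_{u,v}$ addressed to it. An $\alpha$-NBD (non-adaptive $\alpha$-Byzantine-Degree) adversary controls in each round $i$ a set $F_i$ of (undirected) edges such that every node is incident to at most $\alpha n$ edges of $F_i$. The sets $F_i$ are unknown to the nodes and depend only on $i$ and on the inputs of the nodes, not on their randomness; the $B$-bit messages delivered over the edges of $F_i$ (in both directions) are chosen by the adversary, arbitrarily, as a function of the inputs, of the communication history of the earlier rounds and of the messages that the nodes intend to send in round $i$. All other messages are delivered unchanged. In a randomized protocol each node has private random coins, independent of those of the other nodes. **Theorem.** For all constants $0<a\le b$ and $c\ge 1$ there is a constant $R=R(a,b,c)$ such that the following holds for all $n\ge 1$, every integer bandwidth $B$ with $a\log n\le B\le b\log n$ (that is, $B=\Theta(\log n)$), and every $0\le\alpha\le 1/(8\cdot 10^4)$. There is a randomized $R$-round protocol in the $B$-Congested Clique on $n$ nodes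 such that, for every $\alpha$-NBD adversary and every input $\{m_{u,v}\}$, with probability at least $1-n^{-c}$ over the coins of the nodes every node $v$ outputs the correct message $m_{u,v}$ for every $u$. Thus $\mathsf{AllToAllComm}$ is solved with high probability in $O(1)$ rounds. -/

import Mathlib

/-- A `B`-bit message. -/
abbrev Msg (B : ℕ) : Type := Fin B → Bool

/-- One message per ordered pair of nodes: `x u v` is the message from `u` to `v`. This describes
the input of `AllToAllComm` as well as the traffic of one round of the `B`-Congested Clique. -/
abbrev Traffic (n B : ℕ) : Type := Fin n → Fin n → Msg B

/-- A randomized synchronous protocol for `AllToAllComm` in the `B`-Congested Clique on the nodes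
`Fin n`. Every node has private coins, drawn uniformly from a finite set, and a local state which
depends only on its identity, its own input, its own coins and the messages it has received. The
first argument of `send` and `receive` is the number of the round (starting from `0`). -/
structure Protocol (n B : ℕ) where
  /-- The finite set from which the private coins of each node are drawn. -/
  Coins : Type
  [fintypeCoins : Fintype Coins]
  [nonemptyCoins : Nonempty Coins]
  /-- The local states. -/
  State : Type
  /-- The initial state of a node `u`, given its input row `(m u v)_v` and its coins. -/
  init : Fin n → (Fin n → Msg B) → Coins → State
  /-- The `B`-bit message that a node intends to send to each node in a round. -/
  send : ℕ → Fin n → State → Fin n → Msg B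
  /-- The new state of a node, given the message it received from each node in a round. -/
  receive : ℕ → Fin n → State → (Fin n → Msg B) → State
  /-- `output v s u` is what node `v`, in state `s`, outputs as the message of `u` to `v`. -/
  output : Fin n → State → Fin n → Msg B

attribute [instance] Protocol.fintypeCoins Protocol.nonemptyCoins

/-- The communication history: for each past round, latest round first, the messages that the
nodes intended to send and the messages that were delivered. -/
abbrev History (n B : ℕ) : Type := List (Traffic n B × Traffic n B)

/-- A non-adaptive mobile Byzantine edge adversary. The controlled edges of each round depend only
on the inputs (the initial states without the randomness) and on the number of the round. The
content it writes on these edges may depend also on the communication history of the earlier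
rounds and on the messages that all nodes intend to send in the current round. -/
structure NonAdaptiveAdversary (n B : ℕ) where
  /-- The set of (undirected) edges of the clique that are controlled in a round. -/
  edges : Traffic n B → ℕ → SimpleGraph (Fin n)
  /-- The messages written on the controlled edges (in both directions). -/
  content : Traffic n B → History n B → Traffic n B → Traffic n B

/-- The adversary is an `α`-Byzantine-Degree adversary: in each round, each node is incident to at
most `α * n` controlled edges. -/
def NonAdaptiveAdversary.IsBoundedDegree {n B : ℕ} (A : NonAdaptiveAdversary n B) (α : ℝ) : Prop :=
  ∀ (m : Traffic n B) (i : ℕ) (v : Fin n), (((A.edges m i).neighborSet v).ncard : ℝ) ≤ α * n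

open Classical in
/-- The messages delivered in round `i`, when `x` are the messages the nodes intend to send. -/
noncomputable def NonAdaptiveAdversary.deliver {n B : ℕ} (A : NonAdaptiveAdversary n B)
    (m : Traffic n B) (i : ℕ) (h : History n B) (x : Traffic n B) : Traffic n B :=
  fun u v => if (A.edges m i).Adj u v then A.content m h x u v else x u v

/-- The local states and the communication history after the first `i` rounds of `P` on the input
`m`, against the adversary `A`, when node `u` has the coins `ω u`. -/
noncomputable def Protocol.run {n B : ℕ} (P : Protocol n B) (A : NonAdaptiveAdversary n B)
    (m : Traffic n B) (ω : Fin n → P.Coins) : ℕ → (Fin n → P.State) × History n B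
  | 0 => (fun u => P.init u (m u) (ω u), [])
  | i + 1 =>
    let s := (P.run A m ω i).1
    let h := (P.run A m ω i).2
    let x : Traffic n B := fun u v => P.send i u (s u) v
    let y : Traffic n B := A.deliver m i h x
    (fun v => P.receive i v (s v) (fun u => y u v), (x, y) :: h)

/-- After `R` rounds, every node `v` outputs all the messages `m u v` addressed to it. -/
def Protocol.Succeeds {n B : ℕ} (P : Protocol n B) (R : ℕ) (A : NonAdaptiveAdversary n B)
    (m : Traffic n B) (ω : Fin n → P.Coins) : Prop :=
  ∀ u v : Fin n, P.output v ((P.run A m ω R).1 v) u = m u v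

/-- The probability that `P` solves `AllToAllComm` on the input `m` against `A` within `R` rounds,
when the nodes draw their coins independently and uniformly. -/
noncomputable def Protocol.successProb {n B : ℕ} (P : Protocol n B) (R : ℕ)
    (A : NonAdaptiveAdversary n B) (m : Traffic n B) : ENNReal :=
  (PMF.uniformOfFintype (Fin n → P.Coins)).toOuterMeasure {ω | P.Succeeds R A m ω}

/-! For large n, identify q² of the nodes with the points of the affine plane over `ZMod q`, where q
is prime and q² ≤ n ≤ 4q², and embed all nodes in a grid of 24 classes, q groups per class and q/5
places per group. The q/5 messages from one source to one group form a block, encoded into q symbols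
of B bits. These travel along the q points of a line to a collector, the plane point indexed by the
pair of groups. The collector decodes the blocks of its source group, regroups the messages by
target, and sends them on over lines in the same way. The lines used form one parallel family,
indexed so that every edge carries a single symbol per round; four rounds serve a pair of classes
(`Layout.estimate_eq`).

The slope and offset of the family are a random seed. Points of a random line with distinct
abscissae are independent, so by Chebyshev a sparse set of controlled relays meets a given line too
often for at most q of the q² seeds (`card_filter_lineHits_le`). Four such events can spoil a
message, hence at most 4q seeds are bad for it. Taking the majority over 2s independent seeds brings
the failure probability down to (16/q)^s, which survives a union bound over the n² messages.

One node draws all seeds and broadcasts them through all nodes (`majority_relay`). Making them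
public is harmless: the controlled edges are fixed by input and round, and decoding tolerates
arbitrary contents on them. For bounded n all inputs are broadcast one by one. -/

/-! ### Transcripts of executions -/

/-- The protocol in which every node records all the messages it receives. -/
def recordProtocol {n B : ℕ} (C : Type) [Fintype C] [Nonempty C]
    (snd : ℕ → Fin n → (Fin n → Msg B) → C → (ℕ → Fin n → Msg B) → Fin n → Msg B)
    (out : Fin n → (ℕ → Fin n → Msg B) → Fin n → Msg B) : Protocol n B where
  Coins := C
  State := (Fin n → Msg B) × C × (ℕ → Fin n → Msg B)
  init _ row c := (row, c, fun _ _ _ => false)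
  send i u s v := snd i u s.1 s.2.1 s.2.2 v
  receive i _ s y := (s.1, s.2.1, Function.update s.2.2 i y)
  output v s u := out v s.2.2 u

/-- The messages delivered to `v` in the rounds before `i`. -/
def recordBefore {n B : ℕ} (Y : ℕ → Traffic n B) (i : ℕ) (v : Fin n) : ℕ → Fin n → Msg B :=
  fun j w => if j < i then Y j w v else fun _ => false

theorem recordBefore_apply {n B : ℕ} (Y : ℕ → Traffic n B) {i j : ℕ} (h : j < i) (v : Fin n) :
    recordBefore Y i v j = fun w => Y j w v := by
  funext w
  simp [recordBefore, h]

/-- Correctness never needs to know what the adversary writes, so the execution can be replaced by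
delivered traffic `Y` constrained only on uncontrolled edges. -/
theorem exists_transcript {n B : ℕ} (C : Type) [Fintype C] [Nonempty C]
    (snd : ℕ → Fin n → (Fin n → Msg B) → C → (ℕ → Fin n → Msg B) → Fin n → Msg B)
    (out : Fin n → (ℕ → Fin n → Msg B) → Fin n → Msg B)
    (A : NonAdaptiveAdversary n B) (m : Traffic n B) (ω : Fin n → C) :
    ∃ Y : ℕ → Traffic n B,
      (∀ i u v, ¬ (A.edges m i).Adj u v →
        Y i u v = snd i u (m u) (ω u) (recordBefore Y i u) v) ∧
      ∀ R u v, (recordProtocol C snd out).output v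
        (((recordProtocol C snd out).run A m ω R).1 v) u = out v (recordBefore Y R v) u := by
  set P := recordProtocol C snd out with hP
  let X : ℕ → Traffic n B := fun i u v => P.send i u ((P.run A m ω i).1 u) v
  let Y : ℕ → Traffic n B := fun i => A.deliver m i (P.run A m ω i).2 (X i)
  have key : ∀ i u, (P.run A m ω i).1 u = (m u, ω u, recordBefore Y i u) := by
    intro i
    induction i with
    | zero => intro u; rfl
    | succ i ih =>
      intro u
      have h1 : (P.run A m ω (i + 1)).1 u
          = P.receive i u ((P.run A m ω i).1 u) (fun w => Y i w u) := rfl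
      rw [h1, ih u]
      change (m u, ω u, Function.update (recordBefore Y i u) i (fun w => Y i w u)) = _
      congr 2
      funext j w
      by_cases hj : j = i
      · subst hj; simp [recordBefore]
      · have : j < i + 1 ↔ j < i := by omega
        simp [recordBefore, hj, this]
  refine ⟨Y, fun i u v hadj => ?_, fun R u v => ?_⟩
  · have h1 : Y i u v = X i u v := by
      simp [Y, NonAdaptiveAdversary.deliver, hadj]
    rw [h1]
    change P.send i u ((P.run A m ω i).1 u) v = _
    rw [key]
    rfl
  · rw [key]
    rfl

/-! ### Majority votes and relaying through all nodes -/

open Classical in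
/-- The value taken by `f` on more than half of the indices, if there is one. -/
noncomputable def majority {ι α : Type*} [Fintype ι] [Nonempty α] (f : ι → α) : α :=
  Classical.epsilon fun a => 2 * (Finset.univ.filter fun i => f i ≠ a).card < Fintype.card ι

-- Two values that each occupy more than half of the indices share an index, so the chosen value is
-- the only one possible.
open Classical in
theorem majority_eq {ι α : Type*} [Fintype ι] [Nonempty α] (f : ι → α) (a : α)
    (h : 2 * (Finset.univ.filter fun i => f i ≠ a).card < Fintype.card ι) : majority f = a := by
  have h' := Classical.epsilon_spec
    (p := fun a => 2 * (Finset.univ.filter fun i => f i ≠ a).card < Fintype.card ι) ⟨a, h⟩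
  change 2 * (Finset.univ.filter fun i => f i ≠ majority f).card < Fintype.card ι at h'
  by_contra hne
  have hcov : (Finset.univ : Finset ι) ⊆ (Finset.univ.filter fun i => f i ≠ majority f) ∪
      (Finset.univ.filter fun i => f i ≠ a) := by
    intro i _
    by_cases hi : f i = a
    · refine Finset.mem_union_left _ ?_
      simp only [Finset.mem_filter, Finset.mem_univ, true_and]
      rw [hi]
      exact fun h => hne h.symm
    · exact Finset.mem_union_right _ (by simp [hi])
  have := (Finset.card_le_card hcov).trans (Finset.card_union_le _ _)
  rw [Finset.card_univ] at this
  omega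

/-- Each node has at most `n / 80000` incident edges. -/
def SparseGraph {n : ℕ} (G : SimpleGraph (Fin n)) : Prop :=
  ∀ v, 80000 * (G.neighborSet v).ncard ≤ n

open Classical in
theorem SparseGraph.card_filter_le {n : ℕ} {G : SimpleGraph (Fin n)} (h : SparseGraph G)
    (v : Fin n) : 80000 * (Finset.univ.filter fun w => G.Adj v w).card ≤ n := by
  have := h v
  rwa [Set.ncard_eq_toFinset_card', show (G.neighborSet v).toFinset =
    Finset.univ.filter fun w => G.Adj v w by ext; simp] at this

theorem NonAdaptiveAdversary.IsBoundedDegree.sparseGraph {n B : ℕ} {A : NonAdaptiveAdversary n B}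
    {α : ℝ} (hA : A.IsBoundedDegree α) (hα : α ≤ 1 / (8 * 10 ^ 4)) (m : Traffic n B) (i : ℕ) :
    SparseGraph (A.edges m i) := by
  intro v
  have h1 := hA m i v
  have h2 : α * n ≤ 1 / (8 * 10 ^ 4) * n := mul_le_mul_of_nonneg_right hα (Nat.cast_nonneg n)
  have h3 : (80000 : ℝ) * ((A.edges m i).neighborSet v).ncard ≤ n := by
    linarith
  exact_mod_cast h3

/-- Relaying a value through all nodes and taking the majority is resilient. -/
theorem majority_relay {n B : ℕ} {G₀ G₁ : SimpleGraph (Fin n)} (h₀ : SparseGraph G₀)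
    (h₁ : SparseGraph G₁) (s v : Fin n) (z : Msg B) (y : Fin n → Msg B) (y' : Fin n → Msg B)
    (hy : ∀ w, ¬ G₀.Adj s w → y w = z) (hy' : ∀ w, ¬ G₁.Adj w v → y' w = y w) :
    majority y' = z := by
  classical
  apply majority_eq
  -- A relay misreports only if its edge to the sender or its edge to the receiver is controlled,
  -- which affects at most 2n/80000 relays.
  have hsub : (Finset.univ.filter fun w => y' w ≠ z) ⊆
      (Finset.univ.filter fun w => G₀.Adj s w) ∪ (Finset.univ.filter fun w => G₁.Adj v w) := by
    intro w hw
    simp only [Finset.mem_filter, Finset.mem_univ, true_and, Finset.mem_union] at hw ⊢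
    by_contra hcon
    push Not at hcon
    exact hw ((hy' w fun h => hcon.2 h.symm).trans (hy w hcon.1))
  have h2 := (Finset.card_le_card hsub).trans (Finset.card_union_le _ _)
  have h3 := h₀.card_filter_le s
  have h4 := h₁.card_filter_le v
  have h5 : 0 < n := s.pos
  rw [Fintype.card_fin]
  convert (show 2 * (Finset.univ.filter fun w => y' w ≠ z).card < n by omega)

/-! ### Deterministic protocol for bounded n -/

theorem le_successProb_of_forall {n B : ℕ} (P : Protocol n B) (R : ℕ)
    (A : NonAdaptiveAdversary n B) (m : Traffic n B) (h : ∀ ω, P.Succeeds R A m ω) (x : ℝ)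
    (hx : x ≤ 1) : ENNReal.ofReal x ≤ P.successProb R A m := by
  have h1 : {ω | P.Succeeds R A m ω} = Set.univ := Set.eq_univ_of_forall h
  rw [Protocol.successProb, h1]
  have h2 : (PMF.uniformOfFintype (Fin n → P.Coins)).toOuterMeasure Set.univ = 1 := by
    rw [PMF.toOuterMeasure_apply_eq_one_iff]
    exact Set.subset_univ _
  rw [h2]
  exact ENNReal.ofReal_le_one.2 hx

/-- Broadcasting all the inputs one by one solves the problem in `2 * n ^ 2` rounds. -/
theorem exists_protocol_quadratic (n B : ℕ) : ∃ P : Protocol n B,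
    ∀ A : NonAdaptiveAdversary n B, ∀ m : Traffic n B, (∀ i, SparseGraph (A.edges m i)) →
      ∀ R, 2 * (n * n) ≤ R → ∀ ω, P.Succeeds R A m ω := by
  classical
  let e : Fin n × Fin n ≃ Fin (n * n) := finProdFinEquiv
  let snd : ℕ → Fin n → (Fin n → Msg B) → Unit → (ℕ → Fin n → Msg B) → Fin n → Msg B :=
    fun i u row _ r _ =>
      -- Rounds 2k and 2k + 1 are devoted to the k-th ordered pair: its source sends to all relays,
      -- then they forward to everyone.
      if h : i / 2 < n * n then
        if i % 2 = 0 then row (e.symm ⟨i / 2, h⟩).2 else r (i - 1) (e.symm ⟨i / 2, h⟩).1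
      else fun _ => false
  let out : Fin n → (ℕ → Fin n → Msg B) → Fin n → Msg B :=
    fun v r u => majority (r (2 * (e (u, v)).val + 1))
  refine ⟨recordProtocol Unit snd out, fun A m hG R hR ω u v => ?_⟩
  obtain ⟨Y, hY, hout⟩ := exists_transcript Unit snd out A m ω
  rw [hout]
  set k := (e (u, v)).val with hk
  have hkn : k < n * n := (e (u, v)).isLt
  have hek : ∀ h : k < n * n, e.symm ⟨k, h⟩ = (u, v) := fun h => by
    rw [Equiv.symm_apply_eq]
  change majority (recordBefore Y R v (2 * k + 1)) = m u v
  rw [recordBefore_apply Y (by omega)]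
  refine majority_relay (hG (2 * k)) (hG (2 * k + 1)) u v (m u v) (fun w => Y (2 * k) u w) _
    (fun w hw => ?_) (fun w hw => ?_)
  · rw [hY _ _ _ hw]
    have h1 : 2 * k / 2 = k := by omega
    have h2 : 2 * k % 2 = 0 := by omega
    simp only [snd, h1, h2, hkn, hek, dite_true, if_true]
  · rw [hY _ _ _ hw]
    have h1 : (2 * k + 1) / 2 = k := by omega
    have h2 : (2 * k + 1) % 2 ≠ 0 := by omega
    have h3 : 2 * k + 1 - 1 = 2 * k := by omega
    simp only [snd, h1, h2, h3, hkn, hek, dite_true, if_false]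
    rw [recordBefore_apply Y (by omega)]

/-! ### Error-correcting codes -/

-- Choose the set of changed coordinates, then their values. Bounding the number of sets by all
-- subsets costs only one bit per symbol, little when symbols have many bits.
open Classical in
theorem card_hammingBall_le {ι α : Type*} [Fintype ι] [Fintype α] [Nonempty α]
    (c : ι → α) (d : ℕ) :
    (Finset.univ.filter fun y : ι → α => hammingDist c y ≤ d).card
      ≤ 2 ^ Fintype.card ι * Fintype.card α ^ d := by
  have hα : 0 < Fintype.card α := Fintype.card_pos
  have hsub : (Finset.univ.filter fun y : ι → α => hammingDist c y ≤ d) ⊆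
      (Finset.univ.filter fun S : Finset ι => S.card ≤ d).biUnion fun S =>
        Fintype.piFinset fun i => if i ∈ S then Finset.univ else {c i} := by
    intro y hy
    simp only [Finset.mem_filter, Finset.mem_univ, true_and] at hy
    simp only [Finset.mem_biUnion, Finset.mem_filter, Finset.mem_univ, true_and,
      Fintype.mem_piFinset]
    refine ⟨Finset.univ.filter fun i => c i ≠ y i, hy, fun i => ?_⟩
    by_cases h : c i = y i <;> simp [h]
  refine (Finset.card_le_card hsub).trans ?_
  refine (Finset.card_biUnion_le_card_mul _ _ (Fintype.card α ^ d) fun S hS => ?_).trans ?_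
  · simp only [Finset.mem_filter, Finset.mem_univ, true_and] at hS
    rw [Fintype.card_piFinset]
    have : ∀ i, (if i ∈ S then (Finset.univ : Finset α) else {c i}).card
        = if i ∈ S then Fintype.card α else 1 := by
      intro i; split_ifs <;> simp
    simp only [this, Finset.prod_ite_mem, Finset.univ_inter, Finset.prod_const]
    exact Nat.pow_le_pow_right hα hS
  · refine Nat.mul_le_mul_right _ ((Finset.card_le_univ _).trans ?_)
    simp

/-- The Gilbert–Varshamov bound. -/
theorem exists_code {ι α β : Type*} [Fintype ι] [Fintype α] [Fintype β] [Nonempty α]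
    [DecidableEq α] (d : ℕ)
    (h : Fintype.card β * (2 ^ Fintype.card ι * Fintype.card α ^ d)
      ≤ Fintype.card α ^ Fintype.card ι) :
    ∃ f : β → ι → α, ∀ x y, x ≠ y → d < hammingDist (f x) (f y) := by
  classical
  have key : ∀ N, N ≤ Fintype.card β → ∃ C : Finset (ι → α), C.card = N ∧
      ∀ x ∈ C, ∀ y ∈ C, x ≠ y → d < hammingDist x y := by
    intro N
    induction N with
    | zero => intro _; exact ⟨∅, by simp⟩
    | succ N ih =>
      intro hN
      obtain ⟨C, hC, hd⟩ := ih (by omega)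
      obtain ⟨z, hz⟩ : ∃ z, ∀ c ∈ C, d < hammingDist c z := by
        by_contra! hcon
        have hcov : (Finset.univ : Finset (ι → α)) ⊆
            C.biUnion fun c => Finset.univ.filter fun y => hammingDist c y ≤ d := by
          intro z _
          obtain ⟨c, hc, hcz⟩ := hcon z
          simp only [Finset.mem_biUnion, Finset.mem_filter, Finset.mem_univ, true_and]
          exact ⟨c, hc, hcz⟩
        have h1 := (Finset.card_le_card hcov).trans
          (Finset.card_biUnion_le_card_mul _ _ _ fun c _ => by
            convert card_hammingBall_le c d)
        rw [Finset.card_univ, Fintype.card_fun, hC] at h1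
        have hpos : 0 < 2 ^ Fintype.card ι * Fintype.card α ^ d := by
          have : 0 < Fintype.card α := Fintype.card_pos
          positivity
        have h2 := h.trans h1
        have := Nat.le_of_mul_le_mul_right h2 hpos
        omega
      have hzC : z ∉ C := fun hzC => by simpa using hz z hzC
      refine ⟨insert z C, by rw [Finset.card_insert_of_notMem hzC, hC], ?_⟩
      intro x hx y hy hxy
      rw [Finset.mem_insert] at hx hy
      rcases hx with rfl | hx <;> rcases hy with rfl | hy
      · exact absurd rfl hxy
      · rw [hammingDist_comm]; exact hz y hy
      · exact hz x hx
      · exact hd x hx y hy hxy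
  obtain ⟨C, hC, hd⟩ := key _ le_rfl
  have e : β ≃ C := Fintype.equivOfCardEq (by simp [hC])
  exact ⟨fun b => e b, fun x y hxy => hd _ (e x).2 _ (e y).2
    fun h => hxy (e.injective (Subtype.ext h))⟩

/-- A code correcting `d` errors. -/
theorem exists_encode_decode {ι α β : Type*} [Fintype ι] [Fintype α] [Fintype β] [Nonempty α]
    [Nonempty β] [DecidableEq α] (d : ℕ)
    (h : Fintype.card β * (2 ^ Fintype.card ι * Fintype.card α ^ (2 * d))
      ≤ Fintype.card α ^ Fintype.card ι) :
    ∃ (f : β → ι → α) (g : (ι → α) → β), ∀ x y, hammingDist y (f x) ≤ d → g y = x := by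
  obtain ⟨f, hf⟩ := exists_code (β := β) (2 * d) h
  refine ⟨f, fun y => Classical.epsilon fun x => hammingDist y (f x) ≤ d, fun x y hxy => ?_⟩
  have h1 := Classical.epsilon_spec (p := fun x => hammingDist y (f x) ≤ d) ⟨x, hxy⟩
  by_contra hne
  have h2 := hf _ _ hne
  beta_reduce at h2
  have h3 := hammingDist_triangle_left
    (f (Classical.epsilon fun x => hammingDist y (f x) ≤ d)) (f x) y
  omega

/-! ### Random lines in the affine plane -/

/-- The point with first coordinate `x` on the line with parameters `s` and index `l`. -/
def linePoint {F : Type*} [Field F] (s : F × F) (l x : F) : F × F := (x, s.1 * x + s.2 + l)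

/-- For each slope, varying the offset moves the point over abscissa x exactly once through its
vertical line: first-moment uniformity. -/
theorem sum_line {F : Type*} [Field F] [Fintype F] (f : F × F → ℝ) (l x : F) :
    ∑ s : F × F, f (linePoint s l x) = Fintype.card F * ∑ y, f (x, y) := by
  rw [Fintype.sum_prod_type]
  have : ∀ r : F, ∑ b : F, f (linePoint (r, b) l x) = ∑ y, f (x, y) := fun r =>
    (Equiv.sum_comp ((Equiv.addLeft (r * x)).trans (Equiv.addRight l)) fun y => f (x, y))
  simp [this]

/-- Two points with distinct abscissae determine slope and offset, so the seeds biject with pairs of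
ordinates. This is pairwise independence. -/
theorem sum_line_mul {F : Type*} [Field F] [Fintype F] (f : F × F → ℝ) (l : F) {x x' : F}
    (hx : x ≠ x') :
    ∑ s : F × F, f (linePoint s l x) * f (linePoint s l x')
      = (∑ y, f (x, y)) * ∑ y, f (x', y) := by
  rw [Finset.sum_mul_sum, ← Fintype.sum_prod_type']
  have hne : x - x' ≠ 0 := sub_ne_zero.2 hx
  let e : F × F ≃ F × F :=
    { toFun := fun s => (s.1 * x + s.2 + l, s.1 * x' + s.2 + l)
      invFun := fun p => ((p.1 - p.2) / (x - x'), p.1 - l - (p.1 - p.2) / (x - x') * x)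
      left_inv := fun s => by
        have h : (s.1 * x + s.2 + l - (s.1 * x' + s.2 + l)) / (x - x') = s.1 := by
          field_simp
          ring
        refine Prod.ext h ?_
        simp only [h]
        ring
      right_inv := fun p => by
        refine Prod.ext ?_ ?_
        · simp only
          ring
        · simp only
          field_simp
          ring }
  exact Equiv.sum_comp e fun p => f (x, p.1) * f (x', p.2)

open Classical in
/-- The number of points of `A` on a line. -/
noncomputable def lineHits {F : Type*} [Field F] [Fintype F] (A : Finset (F × F)) (s : F × F)
    (l : F) : ℕ :=
  (Finset.univ.filter fun x => linePoint s l x ∈ A).card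

/-- Variance of a sum of pairwise independent indicators, multiplied by the number q² of seeds: the
covariances vanish and only the diagonal contributes. -/
theorem sum_sq_lineHits_sub_le {F : Type*} [Field F] [Fintype F] (A : Finset (F × F)) (l : F) :
    ∑ s : F × F, ((lineHits A s l : ℝ) - A.card / Fintype.card F) ^ 2
      ≤ Fintype.card F * A.card := by
  classical
  set q : ℝ := ((Fintype.card F : ℕ) : ℝ) with hq
  have hq0 : 0 < q := by rw [hq]; exact_mod_cast Fintype.card_pos
  let f : F × F → ℝ := fun p => if p ∈ A then 1 else 0
  have hf0 : ∀ p, 0 ≤ f p := fun p => by simp only [f]; split_ifs <;> norm_num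
  have hff : ∀ p, f p * f p = f p := fun p => by simp only [f]; split_ifs <;> norm_num
  have hhits : ∀ s, (lineHits A s l : ℝ) = ∑ x, f (linePoint s l x) := by
    intro s
    simp [lineHits, f]
  let a : F → ℝ := fun x => ∑ y, f (x, y)
  have ha0 : ∀ x, 0 ≤ a x := fun x => Finset.sum_nonneg fun y _ => hf0 _
  have ha : ∑ x, a x = A.card := by
    simp only [a]
    rw [← Fintype.sum_prod_type]
    simp [f]
  have h1 : ∑ s : F × F, (lineHits A s l : ℝ) = q * A.card := by
    simp only [hhits]
    rw [Finset.sum_comm]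
    simp only [sum_line]
    rw [← Finset.mul_sum, ← ha]
  have h2 : ∑ s : F × F, (lineHits A s l : ℝ) ^ 2 ≤ q * A.card + (A.card : ℝ) ^ 2 := by
    have h3 : ∑ s : F × F, (lineHits A s l : ℝ) ^ 2
        = ∑ x, ∑ x', ∑ s : F × F, f (linePoint s l x) * f (linePoint s l x') := by
      simp only [hhits, sq, Finset.sum_mul_sum]
      rw [Finset.sum_comm]
      refine Finset.sum_congr rfl fun x _ => ?_
      rw [Finset.sum_comm]
    have h4 : ∀ x x', ∑ s : F × F, f (linePoint s l x) * f (linePoint s l x')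
        ≤ a x * a x' + if x = x' then q * a x else 0 := by
      intro x x'
      by_cases hx : x = x'
      · subst hx
        simp only [hff, if_true, sum_line]
        have := mul_nonneg (ha0 x) (ha0 x)
        linarith
      · rw [sum_line_mul f l hx, if_neg hx, add_zero]
    rw [h3]
    refine (Finset.sum_le_sum fun x _ => Finset.sum_le_sum fun x' _ => h4 x x').trans ?_
    simp only [Finset.sum_add_distrib, Finset.sum_ite_eq, Finset.mem_univ, if_true]
    rw [← Finset.mul_sum, ← Finset.sum_mul_sum, ha]
    linarith [sq (A.card : ℝ)]
  have h3 : ∑ s : F × F, ((lineHits A s l : ℝ) - A.card / q) ^ 2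
      = ∑ s : F × F, (lineHits A s l : ℝ) ^ 2
        - 2 * (A.card / q) * ∑ s : F × F, (lineHits A s l : ℝ) + q ^ 2 * (A.card / q) ^ 2 := by
    have h4 : ∀ s, ((lineHits A s l : ℝ) - A.card / q) ^ 2
        = (lineHits A s l : ℝ) ^ 2 - 2 * (A.card / q) * lineHits A s l + (A.card / q) ^ 2 :=
      fun s => by ring
    simp only [h4, Finset.sum_add_distrib, Finset.sum_sub_distrib, ← Finset.mul_sum]
    simp [hq, sq]
  rw [h3, h1]
  have h5 : 2 * (A.card / q) * (q * A.card) = 2 * (A.card : ℝ) ^ 2 := by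
    field_simp
  have h6 : q ^ 2 * (A.card / q) ^ 2 = (A.card : ℝ) ^ 2 := by
    field_simp
  linarith

/-- A sparse set is hit often by few lines. -/
theorem card_filter_lineHits_le {F : Type*} [Field F] [Fintype F] (A : Finset (F × F)) (l : F)
    (h : ℕ) (hA : 1000 * A.card ≤ Fintype.card F ^ 2) (hh : Fintype.card F ≤ 11 * h) :
    (Finset.univ.filter fun s : F × F => h < lineHits A s l).card ≤ Fintype.card F := by
  set N := (Finset.univ.filter fun s : F × F => h < lineHits A s l).card with hN
  have h0 := sum_sq_lineHits_sub_le A l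
  have hA' : (1000 : ℝ) * A.card ≤ (Fintype.card F : ℝ) ^ 2 := by exact_mod_cast hA
  have hh' : (Fintype.card F : ℝ) ≤ 11 * h := by exact_mod_cast hh
  have hq0 : (0 : ℝ) < Fintype.card F := by exact_mod_cast Fintype.card_pos
  set q : ℝ := ((Fintype.card F : ℕ) : ℝ) with hq
  have hmu : A.card / q ≤ q / 1000 := by
    rw [div_le_iff₀ hq0]
    nlinarith
  -- Chebyshev: a line with more than h ≥ q/11 hits exceeds the mean, at most q/1000, by at least
  -- q/12.
  have h1 : (N : ℝ) * (q / 12) ^ 2 ≤ q * A.card := by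
    refine le_trans ?_ h0
    rw [hN, ← nsmul_eq_mul]
    refine le_trans (Finset.card_nsmul_le_sum _ _ _ fun s hs => ?_)
      (Finset.sum_le_univ_sum_of_nonneg fun s => sq_nonneg _)
    have hs' : (h : ℝ) < lineHits A s l := by
      exact_mod_cast (Finset.mem_filter.1 hs).2
    refine pow_le_pow_left₀ (by positivity) ?_ 2
    linarith
  have h2 : (N : ℝ) * (q / 12) ^ 2 ≤ q * (q / 12) ^ 2 := by
    nlinarith
  have h3 := le_of_mul_le_mul_right h2 (by positivity)
  rw [hq] at h3
  exact_mod_cast h3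

/-- The index of the line with parameters `s` through a point. -/
def lineIndex {F : Type*} [Field F] (s p : F × F) : F := p.2 - s.1 * p.1 - s.2

theorem lineIndex_linePoint {F : Type*} [Field F] (s : F × F) (l x : F) :
    lineIndex s (linePoint s l x) = l := by
  simp only [lineIndex, linePoint]
  ring

/-! ### The four-step relay scheme -/

/-- The public data of the relay protocol: the nodes that serve as points of the affine plane, the
coordinates (class, group in the class, index in the group) of all nodes, and a code which corrects
`2 * h` errors. -/
structure Layout (n B : ℕ) (F : Type) [Field F] [Fintype F] (D k h : ℕ) where
  /-- The node of a point of the plane. -/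
  pt : F × F → Fin n
  /-- The point of a node. -/
  plane : Fin n → F × F
  plane_pt : ∀ p, plane (pt p) = p
  /-- The class of a node. -/
  cls : Fin n → Fin D
  /-- The group of a node within its class. -/
  grp : Fin n → F
  /-- The index of a node within its group. -/
  idx : Fin n → Fin k
  /-- The node with given coordinates. -/
  node : Fin D → F → Fin k → Fin n
  node_coord : ∀ u, node (cls u) (grp u) (idx u) = u
  /-- The indices within a group as elements of the field. -/
  toF : Fin k → F
  /-- The inverse of `toF`. -/
  ofF : F → Fin k
  ofF_toF : ∀ a, ofF (toF a) = a
  /-- The encoder. -/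
  enc : (Fin k → Msg B) → F → Msg B
  /-- The decoder. -/
  dec : (F → Msg B) → Fin k → Msg B
  dec_eq : ∀ x y, hammingDist y (enc x) ≤ 2 * h → dec y = x

namespace Layout

variable {n B : ℕ} {F : Type} [Field F] [Fintype F] {D k h : ℕ}

/-- What a node reads off the relays of the line with index `l`. -/
def decodeLine (L : Layout n B F D k h) (s : F × F) (r : Fin n → Msg B) (l : F) : Fin k → Msg B :=
  L.dec fun x => r (L.pt (linePoint s l x))

/-- First step: the source `u` spreads its messages to the groups of the class `c₂`. -/
def spread (L : Layout n B F D k h) (s : F × F) (c₂ : Fin D) (u : Fin n) (row : Fin n → Msg B)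
    (w : Fin n) : Msg B :=
  L.enc (fun a => row (L.node c₂ (lineIndex s (L.plane w) - L.toF (L.idx u)) a)) (L.plane w).1

/-- Second step: the relay `p` forwards to the collectors what it received from the sources. -/
def collect (L : Layout n B F D k h) (s : F × F) (c₁ : Fin D) (p : Fin n) (r : Fin n → Msg B)
    (w : Fin n) : Msg B :=
  r (L.node c₁ (L.plane w).1 (L.ofF (lineIndex s (L.plane p) - (L.plane w).2)))

/-- Third step: the collector `w` spreads what it decoded. -/
def respread (L : Layout n B F D k h) (s : F × F) (w : Fin n) (r : Fin n → Msg B)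
    (p : Fin n) : Msg B :=
  L.enc (fun a => L.decodeLine s r (L.toF a + (L.plane w).2)
    (L.ofF (lineIndex s (L.plane p) - (L.plane w).1))) (L.plane p).1

/-- Fourth step: the relay `p` forwards to the targets what it received from the collectors. -/
def distribute (L : Layout n B F D k h) (s : F × F) (p : Fin n) (r : Fin n → Msg B)
    (v : Fin n) : Msg B :=
  r (L.pt (lineIndex s (L.plane p) - L.toF (L.idx v), L.grp v))

/-- The message of `u` as decoded by the target `v`. -/
def estimate (L : Layout n B F D k h) (s : F × F) (v : Fin n) (r : Fin n → Msg B)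
    (u : Fin n) : Msg B :=
  L.decodeLine s r (L.toF (L.idx v) + L.grp u) (L.idx u)

open Classical in
/-- The relays that are joined to `a` by an edge of `G`. -/
noncomputable def badPoints (L : Layout n B F D k h) (G : SimpleGraph (Fin n)) (a : Fin n) :
    Finset (F × F) :=
  Finset.univ.filter fun p => G.Adj a (L.pt p)

/-- A symbol passes two edges, into the relay and out of it. Each endpoint spoils at most h relays
of the line, which is why the code must correct 2h errors. -/
theorem decodeLine_eq (L : Layout n B F D k h) (s : F × F) (r : Fin n → Msg B) (l : F)
    (x : Fin k → Msg B) {G G' : SimpleGraph (Fin n)} {a a' : Fin n}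
    (hG : lineHits (L.badPoints G a) s l ≤ h) (hG' : lineHits (L.badPoints G' a') s l ≤ h)
    (hr : ∀ t, ¬ G.Adj a (L.pt (linePoint s l t)) → ¬ G'.Adj a' (L.pt (linePoint s l t)) →
      r (L.pt (linePoint s l t)) = L.enc x t) :
    L.decodeLine s r l = x := by
  classical
  apply L.dec_eq
  have hsub : (Finset.univ.filter fun t => r (L.pt (linePoint s l t)) ≠ L.enc x t) ⊆
      (Finset.univ.filter fun t => linePoint s l t ∈ L.badPoints G a) ∪
      (Finset.univ.filter fun t => linePoint s l t ∈ L.badPoints G' a') := by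
    intro t ht
    simp only [Finset.mem_filter, Finset.mem_univ, true_and, Finset.mem_union, badPoints] at ht ⊢
    by_contra hcon
    push Not at hcon
    exact ht (hr t hcon.1 hcon.2)
  have h2 := (Finset.card_le_card hsub).trans (Finset.card_union_le _ _)
  simp only [lineHits] at hG hG'
  have h3 : hammingDist (fun t => r (L.pt (linePoint s l t))) (L.enc x)
      = (Finset.univ.filter fun t => r (L.pt (linePoint s l t)) ≠ L.enc x t).card := by
    simp [hammingDist]
  rw [h3]
  refine h2.trans ?_
  rw [two_mul]
  refine add_le_add (le_trans (le_of_eq ?_) hG) (le_trans (le_of_eq ?_) hG') <;> congr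

/-- Both halves of the route are instances of `decodeLine_eq`: source to collector over the line
`idx u + grp v`, collector to target over the line `idx v + grp u`. Given the line of a relay and
one summand, the other is recovered by subtraction, so each relay knows which symbol to forward. -/
theorem estimate_eq (L : Layout n B F D k h) (s : F × F) {G₀ G₁ G₂ G₃ : SimpleGraph (Fin n)}
    (m Y₀ Y₁ Y₂ Y₃ : Traffic n B) (u v : Fin n)
    (h₀ : ∀ u w, ¬ G₀.Adj u w → Y₀ u w = L.spread s (L.cls v) u (m u) w)
    (h₁ : ∀ p w, ¬ G₁.Adj p w → Y₁ p w = L.collect s (L.cls u) p (fun u => Y₀ u p) w)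
    (h₂ : ∀ w p, ¬ G₂.Adj w p → Y₂ w p = L.respread s w (fun p => Y₁ p w) p)
    (h₃ : ∀ p v, ¬ G₃.Adj p v → Y₃ p v = L.distribute s p (fun w => Y₂ w p) v)
    (g₀ : lineHits (L.badPoints G₀ u) s (L.toF (L.idx u) + L.grp v) ≤ h)
    (g₁ : lineHits (L.badPoints G₁ (L.pt (L.grp u, L.grp v))) s (L.toF (L.idx u) + L.grp v) ≤ h)
    (g₂ : lineHits (L.badPoints G₂ (L.pt (L.grp u, L.grp v))) s (L.toF (L.idx v) + L.grp u) ≤ h)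
    (g₃ : lineHits (L.badPoints G₃ v) s (L.toF (L.idx v) + L.grp u) ≤ h) :
    L.estimate s v (fun p => Y₃ p v) u = m u v := by
  set w := L.pt (L.grp u, L.grp v) with hw
  have hpw : L.plane w = (L.grp u, L.grp v) := L.plane_pt _
  have hlp : ∀ l t, (linePoint s l t).1 = t := fun _ _ => rfl
  have key : L.decodeLine s (fun p => Y₁ p w) (L.toF (L.idx u) + L.grp v)
      = fun a => m u (L.node (L.cls v) (L.grp v) a) := by
    refine L.decodeLine_eq s _ _ _ g₀ g₁ fun t ht ht' => ?_
    rw [h₁ _ _ fun h => ht' h.symm]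
    simp only [collect, hpw, L.plane_pt, lineIndex_linePoint, add_sub_cancel_right, L.ofF_toF,
      L.node_coord]
    rw [h₀ _ _ ht]
    simp only [spread, L.plane_pt, lineIndex_linePoint, add_sub_cancel_left, hlp]
  have key' : L.decodeLine s (fun p => Y₃ p v) (L.toF (L.idx v) + L.grp u)
      = fun a => L.decodeLine s (fun p => Y₁ p w) (L.toF a + L.grp v) (L.idx v) := by
    refine L.decodeLine_eq s _ _ _ g₂ g₃ fun t ht ht' => ?_
    rw [h₃ _ _ fun h => ht' h.symm]
    simp only [distribute, L.plane_pt, lineIndex_linePoint, add_sub_cancel_left]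
    rw [← hw, h₂ _ _ ht]
    simp only [respread, hpw, L.plane_pt, lineIndex_linePoint, add_sub_cancel_right, L.ofF_toF,
      hlp]
  rw [estimate, key']
  simp only [key, L.node_coord]

/-! ### Counting bad seeds -/

open Classical in
/-- The parameters for which some codeword on the way from `u` to `v` meets too many controlled
edges of the graphs `G 0`, …, `G 3` of the four steps. -/
noncomputable def badSeeds (L : Layout n B F D k h) (G : ℕ → SimpleGraph (Fin n))
    (u v : Fin n) : Finset (F × F) :=
  Finset.univ.filter fun s =>
    ¬ (lineHits (L.badPoints (G 0) u) s (L.toF (L.idx u) + L.grp v) ≤ h ∧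
      lineHits (L.badPoints (G 1) (L.pt (L.grp u, L.grp v))) s (L.toF (L.idx u) + L.grp v) ≤ h ∧
      lineHits (L.badPoints (G 2) (L.pt (L.grp u, L.grp v))) s (L.toF (L.idx v) + L.grp u) ≤ h ∧
      lineHits (L.badPoints (G 3) v) s (L.toF (L.idx v) + L.grp u) ≤ h)

/-- Distinct points are distinct nodes, so the degree bound n/80000 ≤ 80q²/80000 applies to relays.
-/
theorem card_badPoints_le (L : Layout n B F D k h) {G : SimpleGraph (Fin n)} (hG : SparseGraph G)
    (hn : n ≤ 80 * Fintype.card F ^ 2) (a : Fin n) :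
    1000 * (L.badPoints G a).card ≤ Fintype.card F ^ 2 := by
  classical
  have h1 : (L.badPoints G a).card ≤ (Finset.univ.filter fun w => G.Adj a w).card := by
    refine Finset.card_le_card_of_injOn L.pt (fun p hp => ?_) fun p _ p' _ hpp => ?_
    · simpa [badPoints] using hp
    · rw [← L.plane_pt p, hpp, L.plane_pt]
  have h2 := hG.card_filter_le a
  have h4 : 80000 * (L.badPoints G a).card ≤ n := by
    refine le_trans (Nat.mul_le_mul_left _ h1) ?_
    convert h2
  omega

theorem card_badSeeds_le (L : Layout n B F D k h) {G : ℕ → SimpleGraph (Fin n)}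
    (hG : ∀ i, SparseGraph (G i)) (hn : n ≤ 80 * Fintype.card F ^ 2)
    (hh : Fintype.card F ≤ 11 * h) (u v : Fin n) :
    (L.badSeeds G u v).card ≤ 4 * Fintype.card F := by
  classical
  have hb : ∀ i a l, (Finset.univ.filter fun s => h < lineHits (L.badPoints (G i) a) s l).card
      ≤ Fintype.card F := fun i a l => by
    convert card_filter_lineHits_le _ l h (L.card_badPoints_le (hG i) hn a) hh
  let S : ℕ → Fin n → F → Finset (F × F) := fun i a l =>
    Finset.univ.filter fun s => h < lineHits (L.badPoints (G i) a) s l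
  have hsub : L.badSeeds G u v ⊆ ((S 0 u (L.toF (L.idx u) + L.grp v) ∪
      S 1 (L.pt (L.grp u, L.grp v)) (L.toF (L.idx u) + L.grp v)) ∪
      S 2 (L.pt (L.grp u, L.grp v)) (L.toF (L.idx v) + L.grp u)) ∪
      S 3 v (L.toF (L.idx v) + L.grp u) := by
    intro s hs
    simp only [badSeeds, Finset.mem_filter, Finset.mem_univ, true_and] at hs
    simp only [S, Finset.mem_union, Finset.mem_filter, Finset.mem_univ, true_and]
    by_contra hcon
    push Not at hcon
    exact hs ⟨hcon.1.1.1, hcon.1.1.2, hcon.1.2, hcon.2⟩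
  refine (Finset.card_le_card hsub).trans ?_
  have i1 := Finset.card_union_le ((S 0 u (L.toF (L.idx u) + L.grp v) ∪
      S 1 (L.pt (L.grp u, L.grp v)) (L.toF (L.idx u) + L.grp v)) ∪
      S 2 (L.pt (L.grp u, L.grp v)) (L.toF (L.idx v) + L.grp u))
      (S 3 v (L.toF (L.idx v) + L.grp u))
  have i2 := Finset.card_union_le (S 0 u (L.toF (L.idx u) + L.grp v) ∪
      S 1 (L.pt (L.grp u, L.grp v)) (L.toF (L.idx u) + L.grp v))
      (S 2 (L.pt (L.grp u, L.grp v)) (L.toF (L.idx v) + L.grp u))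
  have i3 := Finset.card_union_le (S 0 u (L.toF (L.idx u) + L.grp v))
      (S 1 (L.pt (L.grp u, L.grp v)) (L.toF (L.idx u) + L.grp v))
  have j0 := hb 0 u (L.toF (L.idx u) + L.grp v)
  have j1 := hb 1 (L.pt (L.grp u, L.grp v)) (L.toF (L.idx u) + L.grp v)
  have j2 := hb 2 (L.pt (L.grp u, L.grp v)) (L.toF (L.idx v) + L.grp u)
  have j3 := hb 3 v (L.toF (L.idx v) + L.grp u)
  simp only [S] at i1 i2 i3 ⊢
  omega

end Layout

/-! ### Amplification by repetition and success probability -/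

/-- Fix s of the 2s repetitions that are all bad; there are at most 4^s choices, and the other
coordinates are free. -/
theorem card_filter_often_mem_le {S : Type*} [Fintype S] [DecidableEq S] (s M : ℕ)
    (bad : Fin (2 * s) → Finset S) (hM : ∀ i, (bad i).card ≤ M) :
    (Finset.univ.filter fun x : Fin (2 * s) → S =>
      s ≤ (Finset.univ.filter fun i => x i ∈ bad i).card).card
      ≤ 4 ^ s * (M ^ s * Fintype.card S ^ s) := by
  classical
  have hsub : (Finset.univ.filter fun x : Fin (2 * s) → S =>
      s ≤ (Finset.univ.filter fun i => x i ∈ bad i).card) ⊆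
      (Finset.univ.filter fun T : Finset (Fin (2 * s)) => T.card = s).biUnion fun T =>
        Fintype.piFinset fun i => if i ∈ T then bad i else Finset.univ := by
    intro x hx
    obtain ⟨T, hT, hTs⟩ := Finset.exists_subset_card_eq (Finset.mem_filter.1 hx).2
    simp only [Finset.mem_biUnion, Finset.mem_filter, Finset.mem_univ, true_and,
      Fintype.mem_piFinset]
    refine ⟨T, hTs, fun i => ?_⟩
    split_ifs with hi
    · exact (Finset.mem_filter.1 (hT hi)).2
    · exact Finset.mem_univ _
  refine (Finset.card_le_card hsub).trans ?_
  refine (Finset.card_biUnion_le_card_mul _ _ (M ^ s * Fintype.card S ^ s) fun T hT => ?_).trans ?_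
  · have hT' : T.card = s := (Finset.mem_filter.1 hT).2
    rw [Fintype.card_piFinset]
    calc ∏ i, (if i ∈ T then bad i else Finset.univ).card
        ≤ ∏ i, if i ∈ T then M else Fintype.card S := by
          refine Finset.prod_le_prod' fun i _ => ?_
          split_ifs
          · exact hM i
          · exact le_of_eq Finset.card_univ
      _ = M ^ s * Fintype.card S ^ s := by
          rw [Finset.prod_ite, Finset.prod_const, Finset.prod_const, Finset.filter_mem_eq_inter,
            Finset.univ_inter, hT', Finset.filter_not, Finset.filter_mem_eq_inter,
            Finset.univ_inter, Finset.card_sdiff_of_subset (Finset.subset_univ _), hT',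
            Finset.card_univ, Fintype.card_fin]
          congr 2
          omega
  · refine Nat.mul_le_mul_right _ ((Finset.card_le_univ _).trans ?_)
    simp [pow_mul]

/-- If a protocol succeeds whenever the coins of one node avoid a set, its success probability is
at least the probability of this event. -/
theorem le_successProb_of_coins {n B : ℕ} (P : Protocol n B) (R : ℕ)
    (A : NonAdaptiveAdversary n B) (m : Traffic n B) (z : Fin n) (bad : Finset P.Coins)
    (h : ∀ ω, ω z ∉ bad → P.Succeeds R A m ω) (x : ℝ)
    (hx : (bad.card : ℝ) ≤ (1 - x) * Fintype.card P.Coins) :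
    ENNReal.ofReal x ≤ P.successProb R A m := by
  classical
  have hC : 0 < Fintype.card P.Coins := Fintype.card_pos
  let good : Finset (Fin n → P.Coins) :=
    Fintype.piFinset fun i => if i = z then badᶜ else Finset.univ
  have hgood : good.card = (Fintype.card P.Coins - bad.card) * Fintype.card P.Coins ^ (n - 1) := by
    rw [Fintype.card_piFinset, ← Finset.mul_prod_erase _ _ (Finset.mem_univ z), if_pos rfl,
      Finset.card_compl]
    congr 1
    rw [Finset.prod_congr rfl fun i hi => by rw [if_neg (Finset.ne_of_mem_erase hi)]]
    rw [Finset.prod_const, Finset.card_erase_of_mem (Finset.mem_univ z), Finset.card_univ,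
      Finset.card_univ, Fintype.card_fin]
  have hsub : (good : Set (Fin n → P.Coins)) ⊆ {ω | P.Succeeds R A m ω} := by
    intro ω hω
    refine h ω fun hbad => ?_
    have := Fintype.mem_piFinset.1 (Finset.mem_coe.1 hω) z
    simp [hbad] at this
  refine le_trans ?_ (MeasureTheory.measure_mono hsub)
  rw [PMF.toOuterMeasure_uniformOfFintype_apply, ENNReal.le_div_iff_mul_le
    (Or.inl (by exact_mod_cast Fintype.card_ne_zero)) (Or.inl (ENNReal.natCast_ne_top _))]
  have h1 : Fintype.card (good : Set (Fin n → P.Coins)) = good.card := by simp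
  rw [h1, ← ENNReal.ofReal_natCast, ← ENNReal.ofReal_natCast,
    ← ENNReal.ofReal_mul' (Nat.cast_nonneg _)]
  refine ENNReal.ofReal_le_ofReal ?_
  rw [hgood, Fintype.card_fun, Fintype.card_fin, Nat.cast_mul,
    Nat.cast_sub (Finset.card_le_univ _)]
  have h2 : Fintype.card P.Coins ^ n
      = Fintype.card P.Coins * Fintype.card P.Coins ^ (n - 1) := by
    rw [← pow_succ', Nat.sub_add_cancel z.pos]
  rw [h2, Nat.cast_mul, ← mul_assoc]
  refine mul_le_mul_of_nonneg_right ?_ (Nat.cast_nonneg _)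
  linarith

theorem le_successProb_recordProtocol {n B : ℕ} {C : Type} [Fintype C] [Nonempty C]
    (snd : ℕ → Fin n → (Fin n → Msg B) → C → (ℕ → Fin n → Msg B) → Fin n → Msg B)
    (out : Fin n → (ℕ → Fin n → Msg B) → Fin n → Msg B) (R : ℕ)
    (A : NonAdaptiveAdversary n B) (m : Traffic n B) (z : Fin n) (bad : Finset C)
    (h : ∀ ω : Fin n → C, ω z ∉ bad → (recordProtocol C snd out).Succeeds R A m ω) (x : ℝ)
    (hx : (bad.card : ℝ) ≤ (1 - x) * Fintype.card C) :
    ENNReal.ofReal x ≤ (recordProtocol C snd out).successProb R A m :=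
  le_successProb_of_coins (recordProtocol C snd out) R A m z bad h x hx

-- Union bound over `T`, later the set of ordered pairs of nodes. Fewer than s bad repetitions among
-- 2s leave a strict majority of good ones.
open Classical in
theorem exists_union_often_mem {S T : Type*} [Fintype S] [Fintype T] (s M : ℕ)
    (bad : T → Fin (2 * s) → Finset S) (hM : ∀ p i, (bad p i).card ≤ M) :
    ∃ U : Finset (Fin (2 * s) → S),
      U.card ≤ Fintype.card T * (4 ^ s * (M ^ s * Fintype.card S ^ s)) ∧
      ∀ c ∉ U, ∀ p, (Finset.univ.filter fun i => c i ∈ bad p i).card < s := by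
  refine ⟨Finset.univ.biUnion fun p => Finset.univ.filter fun c : Fin (2 * s) → S =>
    s ≤ (Finset.univ.filter fun i => c i ∈ bad p i).card, ?_, fun c hc p => ?_⟩
  · refine Finset.card_biUnion_le_card_mul _ _ _ fun p _ => ?_
    convert card_filter_often_mem_le s M (bad p) (hM p)
  · by_contra hle
    exact hc (Finset.mem_biUnion.2 ⟨p, Finset.mem_univ _, Finset.mem_filter.2
      ⟨Finset.mem_univ _, not_lt.1 hle⟩⟩)

/-! ### The complete protocol: shared seeds, phases and votes -/

namespace Layout

variable {n B : ℕ} {F : Type} [Field F] [Fintype F] {D k h : ℕ}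

/-- The number of the phase of a repetition and a pair of classes. -/
noncomputable def phase (t D : ℕ) : Fin t × Fin D × Fin D ≃ Fin (t * (D * D)) :=
  (Equiv.prodCongr (Equiv.refl _) finProdFinEquiv).trans finProdFinEquiv

/-- The seeds that a node reads off the first `2 * E` rounds. -/
noncomputable def seeds {E t : ℕ} (cd : (Fin E → Msg B) → Fin t → F × F)
    (r : ℕ → Fin n → Msg B) : Fin t → F × F :=
  cd fun e => majority (r (2 * e + 1))

open Classical in
/-- What the nodes send: first the node `z` broadcasts its coins, which serve as seeds, then the
four steps are run for each seed and each pair of classes. -/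
noncomputable def sendRule (L : Layout n B F D k h) {E t : ℕ}
    (ce : (Fin t → F × F) → Fin E → Msg B) (cd : (Fin E → Msg B) → Fin t → F × F) (z : Fin n)
    (i : ℕ) (u : Fin n) (row : Fin n → Msg B) (c : Fin t → F × F) (r : ℕ → Fin n → Msg B) :
    Fin n → Msg B :=
  if hi : i < 2 * E then
    if i % 2 = 0 then fun _ => ce c ⟨i / 2, by omega⟩ else fun _ => r (i - 1) z
  else if hg : (i - 2 * E) / 4 < t * (D * D) then
    let x := (phase t D).symm ⟨(i - 2 * E) / 4, hg⟩
    let s := seeds cd r x.1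
    if (i - 2 * E) % 4 = 0 then L.spread s x.2.2 u row
    else if (i - 2 * E) % 4 = 1 then L.collect s x.2.1 u (r (i - 1))
    else if (i - 2 * E) % 4 = 2 then L.respread s u (r (i - 1))
    else L.distribute s u (r (i - 1))
  else fun _ _ => false

/-- The first round of a phase. -/
noncomputable def start (E t : ℕ) (x : Fin t × Fin D × Fin D) : ℕ :=
  2 * E + 4 * (phase t D x).val

/-- The outputs: the majority of the estimates of all repetitions. -/
noncomputable def outRule (L : Layout n B F D k h) {E t : ℕ}
    (cd : (Fin E → Msg B) → Fin t → F × F) (v : Fin n) (r : ℕ → Fin n → Msg B) (u : Fin n) :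
    Msg B :=
  majority fun τ => L.estimate (seeds cd r τ) v (r (start E t (τ, L.cls u, L.cls v) + 3)) u

theorem sendRule_start (L : Layout n B F D k h) {E t : ℕ}
    (ce : (Fin t → F × F) → Fin E → Msg B) (cd : (Fin E → Msg B) → Fin t → F × F) (z : Fin n)
    (x : Fin t × Fin D × Fin D) (u : Fin n) (row : Fin n → Msg B) (c : Fin t → F × F)
    (r : ℕ → Fin n → Msg B) (j : ℕ) (hj : j < 4) :
    L.sendRule ce cd z (start E t x + j) u row c r =
      if j = 0 then L.spread (seeds cd r x.1) x.2.2 u row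
      else if j = 1 then L.collect (seeds cd r x.1) x.2.1 u (r (start E t x + j - 1))
      else if j = 2 then L.respread (seeds cd r x.1) u (r (start E t x + j - 1))
      else L.distribute (seeds cd r x.1) u (r (start E t x + j - 1)) := by
  have h1 : ¬ start E t x + j < 2 * E := by simp only [start]; omega
  have h2 : (start E t x + j - 2 * E) / 4 = (phase t D x).val := by simp only [start]; omega
  have h3 : (start E t x + j - 2 * E) % 4 = j := by simp only [start]; omega
  rw [sendRule, dif_neg h1]
  simp only [h2, h3, Fin.is_lt, dite_true, Fin.eta, Equiv.symm_apply_apply]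

-- Once the coins of `z` are fixed the argument is deterministic: all nodes recover the same seeds,
-- and each repetition with a good seed yields the correct estimate. The sets of bad seeds do not
-- depend on the coins because the controlled edges do not.
open Classical in
theorem succeeds (L : Layout n B F D k h) {E t : ℕ}
    (ce : (Fin t → F × F) → Fin E → Msg B) (cd : (Fin E → Msg B) → Fin t → F × F)
    (hcd : ∀ c, cd (ce c) = c) (z : Fin n) (A : NonAdaptiveAdversary n B) (m : Traffic n B)
    (hA : ∀ i, SparseGraph (A.edges m i)) (R : ℕ) (hR : 2 * E + 4 * (t * (D * D)) ≤ R)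
    (ω : Fin n → Fin t → F × F)
    (hω : ∀ u v, 2 * (Finset.univ.filter fun τ => ω z τ ∈ L.badSeeds
      (fun j => A.edges m (start E t (τ, L.cls u, L.cls v) + j)) u v).card < t) :
    (recordProtocol (Fin t → F × F) (L.sendRule ce cd z) (L.outRule cd)).Succeeds R A m ω := by
  classical
  intro u v
  obtain ⟨Y, hY, hout⟩ := exists_transcript _ (L.sendRule ce cd z) (L.outRule cd) A m ω
  rw [hout]
  have hseeds : ∀ i w, 2 * E ≤ i → seeds cd (recordBefore Y i w) = ω z := by
    intro i w hi
    rw [seeds]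
    conv_rhs => rw [← hcd (ω z)]
    congr 1
    funext e
    have he := e.isLt
    rw [recordBefore_apply Y (by omega)]
    refine majority_relay (hA (2 * e)) (hA (2 * e + 1)) z w _ (fun w => Y (2 * e) z w) _
      (fun w hw => ?_) (fun w hw => ?_)
    · rw [hY _ _ _ hw, sendRule, dif_pos (by omega), if_pos (by omega)]
      congr 1
      ext
      simp
    · rw [hY _ _ _ hw, sendRule, dif_pos (by omega), if_neg (by omega)]
      rw [recordBefore_apply Y (by omega)]
      simp
  refine majority_eq _ _ ?_
  rw [Fintype.card_fin]
  refine lt_of_le_of_lt (Nat.mul_le_mul_left 2 (Finset.card_le_card ?_)) (hω u v)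
  intro τ hτ
  simp only [Finset.mem_filter, Finset.mem_univ, true_and] at hτ ⊢
  by_contra hgood
  apply hτ
  set x : Fin t × Fin D × Fin D := (τ, L.cls u, L.cls v) with hx
  simp only [badSeeds, Finset.mem_filter, Finset.mem_univ, true_and, not_not] at hgood
  obtain ⟨g₀, g₁, g₂, g₃⟩ := hgood
  have hb : 2 * E ≤ start E t x := Nat.le_add_right _ _
  have hb' : start E t x + 3 < R := by
    have := (phase t D x).isLt
    simp only [start]
    omega
  rw [hseeds R v (by omega), recordBefore_apply Y hb']
  have hround : ∀ j < 4, ∀ u' v', ¬ (A.edges m (start E t x + j)).Adj u' v' →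
      Y (start E t x + j) u' v' =
      (if j = 0 then L.spread (ω z τ) (L.cls v) u' (m u')
      else if j = 1 then L.collect (ω z τ) (L.cls u) u' fun w => Y (start E t x + j - 1) w u'
      else if j = 2 then L.respread (ω z τ) u' fun w => Y (start E t x + j - 1) w u'
      else L.distribute (ω z τ) u' fun w => Y (start E t x + j - 1) w u') v' := by
    intro j hj u' v' hadj
    rw [hY _ _ _ hadj, L.sendRule_start ce cd z x u' _ _ _ j hj, hseeds _ _ (by omega)]
    rcases Nat.eq_zero_or_pos j with rfl | hj0
    · rfl
    · rw [recordBefore_apply Y (by omega)]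
  exact L.estimate_eq (ω z τ) m (Y (start E t x + 0)) (Y (start E t x + 1)) (Y (start E t x + 2))
    (Y (start E t x + 3)) u v (hround 0 (by omega)) (hround 1 (by omega)) (hround 2 (by omega))
    (hround 3 (by omega)) g₀ g₁ g₂ g₃

-- The hypothesis `hE` lets 2s seeds, each a pair of field elements, fit into E messages; `hx` is
-- the union bound n²(16/q)^s ≤ 1 - x.
open Classical in
theorem exists_protocol (L : Layout n B F D k h) (hn : n ≤ 80 * Fintype.card F ^ 2)
    (hh : Fintype.card F ≤ 11 * h) (z : Fin n) (E s : ℕ)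
    (hE : Fintype.card F ^ (4 * s) ≤ 2 ^ (B * E)) (x : ℝ)
    (hx : (n : ℝ) ^ 2 * 16 ^ s ≤ (1 - x) * (Fintype.card F : ℝ) ^ s) :
    ∃ P : Protocol n B, ∀ A : NonAdaptiveAdversary n B, ∀ m : Traffic n B,
      (∀ i, SparseGraph (A.edges m i)) → ∀ R, 2 * E + 4 * (2 * s * (D * D)) ≤ R →
        ENNReal.ofReal x ≤ P.successProb R A m := by
  have hcard : Fintype.card (Fin (2 * s) → F × F) = Fintype.card F ^ (4 * s) := by
    simp only [Fintype.card_fun, Fintype.card_prod, Fintype.card_fin]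
    rw [← sq, ← pow_mul]
    congr 1
    ring
  obtain ⟨ce⟩ : Nonempty ((Fin (2 * s) → F × F) ↪ (Fin E → Msg B)) := by
    apply Function.Embedding.nonempty_of_card_le
    rw [hcard]
    simpa [← pow_mul] using hE
  refine ⟨recordProtocol (Fin (2 * s) → F × F) (L.sendRule ce (Function.invFun ce) z)
    (L.outRule (Function.invFun ce)), fun A m hA R hR => ?_⟩
  let bad : Fin n × Fin n → Fin (2 * s) → Finset (F × F) := fun p τ => L.badSeeds
    (fun j => A.edges m (start E (2 * s) (τ, L.cls p.1, L.cls p.2) + j)) p.1 p.2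
  obtain ⟨U, hU, hUc⟩ := exists_union_often_mem s (4 * Fintype.card F) bad fun p τ =>
    L.card_badSeeds_le (fun j => hA _) hn hh p.1 p.2
  refine le_successProb_recordProtocol _ _ R A m z U (fun ω hω => ?_) x ?_
  · refine L.succeeds ce _ (Function.leftInverse_invFun ce.injective) z A m hA R hR ω
      fun u v => ?_
    have h1 := hUc _ hω (u, v)
    refine (Nat.mul_lt_mul_left two_pos).2 (lt_of_le_of_lt (le_of_eq ?_) h1)
    congr
  · have h1 : U.card ≤ n * n * (4 ^ s * ((4 * Fintype.card F) ^ s *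
        Fintype.card (F × F) ^ s)) := by
      simpa using hU
    rw [hcard]
    refine (Nat.cast_le.2 h1).trans ?_
    rw [Fintype.card_prod]
    push_cast
    obtain ⟨q, hq⟩ : ∃ q : ℝ, q = (Fintype.card F : ℝ) := ⟨_, rfl⟩
    rw [← hq] at hx ⊢
    have hq0 : 0 ≤ q := by rw [hq]; positivity
    calc (n : ℝ) * n * (4 ^ s * ((4 * q) ^ s * (q * q) ^ s))
        = (n ^ 2 * 16 ^ s) * q ^ (3 * s) := by
          rw [mul_pow, mul_pow, show (16 : ℝ) = 4 * 4 by norm_num, mul_pow,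
            show 3 * s = s + (s + s) by ring, pow_add, pow_add]
          ring
      _ ≤ ((1 - x) * q ^ s) * q ^ (3 * s) := mul_le_mul_of_nonneg_right hx (by positivity)
      _ = (1 - x) * q ^ (4 * s) := by
          rw [mul_assoc, ← pow_add]
          congr 2
          ring

end Layout

/-! ### Choice of parameters -/

/-- Bertrand's postulate applied at half the square root of n. -/
theorem exists_prime_sq_le {n : ℕ} (hn : 4000000 ≤ n) :
    ∃ q : ℕ, q.Prime ∧ q ^ 2 ≤ n ∧ n ≤ 4 * q ^ 2 ∧ 1000 ≤ q := by
  have h1 : 2000 ≤ Nat.sqrt n := Nat.le_sqrt.2 (by omega)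
  obtain ⟨q, hq, hlt, hle⟩ := Nat.exists_prime_lt_and_le_two_mul (Nat.sqrt n / 2) (by omega)
  have h2 : q ≤ Nat.sqrt n := by omega
  have h3 : Nat.sqrt n + 1 ≤ 2 * q := by omega
  have h4 := Nat.sqrt_le' n
  have h5 := Nat.lt_succ_sqrt' n
  refine ⟨q, hq, (Nat.pow_le_pow_left h2 2).trans h4, ?_, by omega⟩
  have h6 := Nat.pow_le_pow_left h3 2
  rw [mul_pow] at h6
  exact h5.le.trans h6

theorem exists_layout {n B q : ℕ} [Fact q.Prime] (hB : 8 ≤ B) (hqn : q ^ 2 ≤ n)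
    (hnq : n ≤ 4 * q ^ 2) (hq : 1000 ≤ q) :
    Nonempty (Layout n B (ZMod q) 24 (q / 5) (q / 10)) := by
  have hn : 0 < n := lt_of_lt_of_le (by positivity) hqn
  have : Nonempty (Fin n) := ⟨⟨0, hn⟩⟩
  have : Nonempty (Fin (q / 5)) := ⟨⟨0, by omega⟩⟩
  obtain ⟨pt⟩ : Nonempty (ZMod q × ZMod q ↪ Fin n) := by
    apply Function.Embedding.nonempty_of_card_le
    simpa [ZMod.card, ← sq] using hqn
  obtain ⟨coord⟩ : Nonempty (Fin n ↪ Fin 24 × ZMod q × Fin (q / 5)) := by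
    apply Function.Embedding.nonempty_of_card_le
    simp only [Fintype.card_prod, Fintype.card_fin, ZMod.card]
    -- Twenty classes would suffice without rounding; 24 absorb the floor in `q / 5`.
    have h1 : 4 * q ≤ 24 * (q / 5) := by omega
    calc n ≤ 4 * q ^ 2 := hnq
      _ = q * (4 * q) := by ring
      _ ≤ q * (24 * (q / 5)) := Nat.mul_le_mul_left _ h1
      _ = 24 * (q * (q / 5)) := by ring
  obtain ⟨toF⟩ : Nonempty (Fin (q / 5) ↪ ZMod q) := by
    apply Function.Embedding.nonempty_of_card_le
    simp only [Fintype.card_fin, ZMod.card]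
    omega
  -- Counting bits: the block takes Bq/5, the error positions q ≤ Bq/8 and the error values 4Bq/10,
  -- together less than Bq.
  obtain ⟨enc, dec, hdec⟩ := exists_encode_decode (ι := ZMod q) (α := Msg B)
    (β := Fin (q / 5) → Msg B) (2 * (q / 10)) (by
      simp only [Fintype.card_fun, Fintype.card_fin, ZMod.card, Fintype.card_bool, ← pow_mul,
        ← pow_add]
      refine Nat.pow_le_pow_right two_pos ?_
      have h1 : 5 * (q / 5) ≤ q := Nat.mul_div_le q 5
      have h2 : 10 * (q / 10) ≤ q := Nat.mul_div_le q 10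
      have h3 := Nat.mul_le_mul_left B h1
      have h4 := Nat.mul_le_mul_left B h2
      have h5 := Nat.mul_le_mul_right q hB
      have h6 : B * (5 * (q / 5)) = 5 * (B * (q / 5)) := by ring
      have h7 : B * (10 * (q / 10)) = 10 * (B * (q / 10)) := by ring
      have h8 : B * (2 * (2 * (q / 10))) = 4 * (B * (q / 10)) := by ring
      rw [h8]
      omega)
  exact ⟨{
    pt := pt
    plane := Function.invFun pt
    plane_pt := Function.leftInverse_invFun pt.injective
    cls := fun u => (coord u).1
    grp := fun u => (coord u).2.1
    idx := fun u => (coord u).2.2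
    node := fun a b c => Function.invFun coord (a, b, c)
    node_coord := fun u => Function.leftInverse_invFun coord.injective u
    toF := toF
    ofF := Function.invFun toF
    ofF_toF := Function.leftInverse_invFun toF.injective
    enc := enc
    dec := dec
    dec_eq := hdec }⟩

/-- With y = n^(1/4) ≥ 32 one has q ≥ y²/2 ≥ 16y, so (16/q)^s ≤ n^(-s/4), and s/4 ≥ c + 2 pays for
the union bound as well. -/
theorem failure_bound {n q s : ℕ} {c : ℝ} (hs : 4 * (c + 2) ≤ s) (hn : 4000000 ≤ n)
    (hnq : n ≤ 4 * q ^ 2) :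
    (n : ℝ) ^ 2 * 16 ^ s ≤ (1 - (1 - 1 / (n : ℝ) ^ c)) * (q : ℝ) ^ s := by
  have hnR : (4000000 : ℝ) ≤ n := by exact_mod_cast hn
  have hn0 : (0 : ℝ) < n := by linarith
  set y : ℝ := (n : ℝ) ^ (1 / 4 : ℝ) with hy
  have hy0 : 0 < y := Real.rpow_pos_of_pos hn0 _
  have hy4 : y ^ 4 = n := by
    rw [hy, ← Real.rpow_natCast, ← Real.rpow_mul hn0.le]
    norm_num
  have hy32 : 32 ≤ y := by
    by_contra! h
    have := pow_lt_pow_left₀ h hy0.le (n := 4) (by norm_num)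
    rw [hy4] at this
    norm_num at this
    linarith
  have hqy : y ^ 2 ≤ 2 * q := by
    have h1 : (n : ℝ) ≤ 4 * (q : ℝ) ^ 2 := by exact_mod_cast hnq
    refine (pow_le_pow_iff_left₀ (by positivity) (by positivity) two_ne_zero).1 ?_
    calc (y ^ 2) ^ 2 = y ^ 4 := by ring
      _ = (n : ℝ) := hy4
      _ ≤ 4 * (q : ℝ) ^ 2 := h1
      _ = (2 * q) ^ 2 := by ring
  have hpow : (n : ℝ) ^ 2 * (n : ℝ) ^ c ≤ y ^ s := by
    rw [hy, ← Real.rpow_natCast, ← Real.rpow_natCast, ← Real.rpow_mul hn0.le,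
      ← Real.rpow_add hn0]
    refine Real.rpow_le_rpow_of_exponent_le (by linarith) ?_
    push_cast
    linarith
  have hnc : (0 : ℝ) < (n : ℝ) ^ c := Real.rpow_pos_of_pos hn0 _
  rw [sub_sub_cancel, one_div, ← div_eq_inv_mul, le_div_iff₀ hnc]
  calc (n : ℝ) ^ 2 * 16 ^ s * (n : ℝ) ^ c = ((n : ℝ) ^ 2 * (n : ℝ) ^ c) * 16 ^ s := by ring
    _ ≤ y ^ s * 16 ^ s := mul_le_mul_of_nonneg_right hpow (by positivity)
    _ = (y * 16) ^ s := (mul_pow _ _ _).symm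
    _ ≤ (q : ℝ) ^ s := pow_le_pow_left₀ (by positivity) (by nlinarith) s

theorem seed_bound {n B q s E : ℕ} {a : ℝ} (ha : 0 < a) (hn : 1 ≤ n)
    (hB : a * Real.log n ≤ B) (hqn : q ^ 2 ≤ n) (hE : 4 * s / a ≤ E) :
    q ^ (4 * s) ≤ 2 ^ (B * E) := by
  have hn0 : (0 : ℝ) < n := by exact_mod_cast hn
  have h1 : q ^ (4 * s) ≤ n ^ (2 * s) := by
    rw [show 4 * s = 2 * (2 * s) by ring, pow_mul]
    exact Nat.pow_le_pow_left hqn _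
  refine h1.trans ?_
  have h2 : ((n : ℝ)) ^ (2 * s) ≤ 2 ^ (B * E) := by
    rw [← Real.log_le_log_iff (by positivity) (by positivity), Real.log_pow, Real.log_pow]
    have hlog : 0 ≤ Real.log n := Real.log_nonneg (by exact_mod_cast hn)
    have h3 : a * Real.log n * (4 * s / a) ≤ B * E :=
      mul_le_mul hB hE (by positivity) (Nat.cast_nonneg _)
    have h4 : a * Real.log n * (4 * s / a) = 4 * s * Real.log n := by field_simp
    -- Only log 2 ≥ 1/2 is needed: BE ≥ 4s log n then gives BE log 2 ≥ 2s log n.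
    have h5 := Real.log_two_gt_d9
    push_cast
    have h6 : (0 : ℝ) ≤ B * E := by positivity
    nlinarith
  exact_mod_cast h2

theorem mainTheorem3 (a b : ℝ) (ha : 0 < a) (hab : a ≤ b) (c : ℝ) (hc : 1 ≤ c) :
    ∃ R : ℕ, ∀ n B : ℕ, 1 ≤ n → a * Real.log n ≤ B → (B : ℝ) ≤ b * Real.log n →
      ∀ α : ℝ, 0 ≤ α → α ≤ 1 / (8 * 10 ^ 4) →
        ∃ P : Protocol n B, ∀ A : NonAdaptiveAdversary n B, A.IsBoundedDegree α →
          ∀ m : Traffic n B,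
            ENNReal.ofReal (1 - 1 / (n : ℝ) ^ c) ≤ P.successProb R A m := by
  obtain ⟨s, hs⟩ := exists_nat_ge (4 * (c + 2))
  obtain ⟨E, hE⟩ := exists_nat_ge (4 * s / a)
  obtain ⟨N, hN⟩ := exists_nat_ge (Real.exp (8 / a))
  -- The sum of the round counts of both cases; extra rounds do no harm. The bound n ≥ exp(8/a)
  -- forces B ≥ 8, as the code requires.
  refine ⟨2 * ((N + 4000000) * (N + 4000000)) + (2 * E + 4 * (2 * s * (24 * 24))),
    fun n B hn hB _ α _ hα => ?_⟩
  by_cases hlarge : N + 4000000 ≤ n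
  · obtain ⟨q, hq, hqn, hnq, hq1000⟩ := exists_prime_sq_le (show 4000000 ≤ n by omega)
    have : Fact q.Prime := ⟨hq⟩
    have hB8 : 8 ≤ B := by
      have h1 : Real.exp (8 / a) ≤ n := hN.trans (by exact_mod_cast (by omega : N ≤ n))
      have h2 : 8 / a ≤ Real.log n := (Real.le_log_iff_exp_le (by positivity)).2 h1
      rw [div_le_iff₀' ha] at h2
      exact_mod_cast h2.trans hB
    obtain ⟨L⟩ := exists_layout (n := n) hB8 hqn hnq hq1000
    obtain ⟨P, hP⟩ := L.exists_protocol (by rw [ZMod.card]; omega) (by rw [ZMod.card]; omega)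
      ⟨0, hn⟩ E s (by rw [ZMod.card]; exact seed_bound ha hn hB hqn hE)
      (1 - 1 / (n : ℝ) ^ c) (by rw [ZMod.card]; exact failure_bound hs (by omega) hnq)
    exact ⟨P, fun A hA m => hP A m (hA.sparseGraph hα m) _ (Nat.le_add_left _ _)⟩
  · obtain ⟨P, hP⟩ := exists_protocol_quadratic n B
    refine ⟨P, fun A hA m => le_successProb_of_forall P _ A m
      (hP A m (hA.sparseGraph hα m) _ ?_) _ ?_⟩
    · have := Nat.mul_le_mul (not_le.1 hlarge).le (not_le.1 hlarge).le
      omega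
    · have : (0 : ℝ) ≤ 1 / (n : ℝ) ^ c := by positivity
      linarith
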